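/- Let $Z$ be a block-diagonal symmetric matrix of variables with diagonal blocks $Z_1,\dots,Z_k$, where $Z_i$ is a symmetric $d_i\times d_i$ matrix of variables, $d_i\ge 1$, and distinct blocks have disjoint sets of variables. For $\alpha\in\mathbb{Z}_{\ge 0}^k$ put $\det(Z)^\alpha=\det(Z_1)^{\alpha_1}\cdots\det(Z_k)^{\alpha_k}$. A complex polynomial $f$ in the entries of a symmetric matrix is called psd-stable if $f(M)\neq 0$ for every complex symmetric matrix $M$ whose imaginary part is positive definite. Let $$f(Z_1,\dots,Z_k)=\det(Z)^\gamma\sum_{\beta\in B}c_\beta\det(Z)^\beta=\det(Z)^\gamma\,\tilde f(Z)$$ be a psd-stable polynomial of determinants in standard form, that is, $\gamma\in\mathbb{Z}_{\ge 0}^k$, $B\subset\mathbb{Z}_{\ge 0}^k$ is finite, $c_\beta\in\mathbb{C}\setminus\{0\}$ for all $\beta\in B$, and the largest possible determinantal monomial is factored out (the only $\delta\in\mathbb{Z}_{\ge 0}^k$ with $\delta\le\beta$ coordinatewise for all $\beta\in B$ is $\delta=0$). Then: 1. Every block $Z_i$ appearing in $\tilde f$ (that is, such that there is $\beta\in B$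 with $\beta_i>0$) has size $d_i\le 2$. 2. For every $i$ with $d_i=2$, let $C_i=\max_{\beta\in B}\beta_i$. If $\beta\in B$, then $\beta+c\,\mathbf{e}_i\in B$ for all integers $c$ with $-\beta_i\le c\le C_i-\beta_i$, where $\mathbf{e}_i$ is the $i$-th unit vector. -/

import Mathlib

/-- The point of `ℂ^(Sym2 ι)` given by the entries of a symmetric matrix: the variable
`z_{ij} = z_{ji}` takes the value `M i j`. -/
def symEntries {ι : Type*} (M : Matrix ι ι ℂ) (hM : M.IsSymm) : Sym2 ι → ℂ :=
  Sym2.lift ⟨fun i j => M i j, fun i j => (hM.apply i j).symm⟩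

/-- Polynomials on symmetric `ι × ι` matrices, that is, polynomials in the variables `z_{ij}`
where `z_{ij}` and `z_{ji}` are identified. -/
abbrev SymMatPoly (ι : Type*) : Type _ := MvPolynomial (Sym2 ι) ℂ

/-- `f` is psd-stable if it has no root among the complex symmetric matrices whose imaginary part
is positive definite. -/
def PsdStable {ι : Type*} (f : SymMatPoly ι) : Prop :=
  ∀ (M : Matrix ι ι ℂ) (hM : M.IsSymm), (M.map Complex.im).PosDef →
    MvPolynomial.eval (symEntries M hM) f ≠ 0

/-- The index set of the rows and columns of a matrix with diagonal blocks of sizes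
`d 0, …, d (k - 1)`. -/
abbrev BlockIndex {k : ℕ} (d : Fin k → ℕ) : Type := Σ i : Fin k, Fin (d i)

/-- The `i`-th diagonal block `Z_i` of the symmetric matrix of variables: a `d i × d i` symmetric
matrix of variables; distinct blocks have disjoint sets of variables. -/
noncomputable def varBlock {k : ℕ} (d : Fin k → ℕ) (i : Fin k) :
    Matrix (Fin (d i)) (Fin (d i)) (SymMatPoly (BlockIndex d)) :=
  Matrix.of fun a b => MvPolynomial.X s(⟨i, a⟩, ⟨i, b⟩)

/-- The determinantal monomial `det(Z)^α = det(Z_1)^{α_1} ⋯ det(Z_k)^{α_k}`. -/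
noncomputable def detMonomial {k : ℕ} (d : Fin k → ℕ) (α : Fin k → ℕ) :
    SymMatPoly (BlockIndex d) :=
  ∏ i, (varBlock d i).det ^ α i

/-- The polynomial of determinants `∑_{β ∈ B} c_β det(Z)^β`. -/
noncomputable def polyOfDets {k : ℕ} (d : Fin k → ℕ) (B : Finset (Fin k → ℕ))
    (c : (Fin k → ℕ) → ℂ) : SymMatPoly (BlockIndex d) :=
  ∑ β ∈ B, MvPolynomial.C (c β) * detMonomial d β

/-- `f = det(Z)^γ ∑_{β ∈ B} c_β det(Z)^β` is a standard form of the polynomial of determinants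
`f`: all `c_β` are nonzero, and the largest possible determinantal monomial is factored out, so
that no nontrivial `det(Z)^δ` can be taken out of all the monomials `det(Z)^β`. -/
structure IsStandardForm {k : ℕ} (d : Fin k → ℕ) (f : SymMatPoly (BlockIndex d))
    (γ : Fin k → ℕ) (B : Finset (Fin k → ℕ)) (c : (Fin k → ℕ) → ℂ) : Prop where
  eq : f = detMonomial d γ * polyOfDets d B c
  coeff_ne_zero : ∀ β ∈ B, c β ≠ 0
  no_common_factor : ∀ δ : Fin k → ℕ, (∀ β ∈ B, δ ≤ β) → δ = 0

/-! On scalar blocks `z_i I` with `Im z_i > 0`, each `det Z_i` becomes `z_i ^ d_i`. Stability thus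
makes `∑ c_β w^β` nonzero whenever every `w_i` is a `d_i`-th power from the upper half plane
(`PsdStable.sum_ne_zero`). Such powers cover the upper half plane in all cases, the complement of
`[0, ∞)` if `d_i = 2`, and all of `ℂ \ {0}` if `d_i ≥ 3`.

Fix the other `w_j` generically in the upper half plane and regard the sum as a polynomial in `w_i`,
whose constant term is nonzero by the standard form. If `d_i ≥ 3` it has no roots at all, so `w_i`
does not occur. If `d_i = 2` all its roots are positive, so by Vieta each coefficient is a nonzero
real multiple of the leading one. These ratios are rational functions of the other `w_j`, real on an
open set, hence constant. All coefficients of powers of `w_i` are therefore proportional and have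
the same support, which is the second claim. -/

/-! ### Powers of points of the upper half plane -/

/-- A nonzero complex number `r e^{iθ}` with `0 < θ < n π` has an `n`-th root in the open upper
half plane. -/
theorem exists_im_pos_pow_eq_of_angle (n : ℕ) (hn : 0 < n) (w : ℂ) (hw : w ≠ 0) (θ : ℝ)
    (hθ : 0 < θ) (hθn : θ < n * Real.pi) (hwθ : w = ‖w‖ * Complex.exp (θ * Complex.I)) :
    ∃ z : ℂ, 0 < z.im ∧ z ^ n = w := by
  have hn' : (0 : ℝ) < n := by exact_mod_cast hn
  have hnC : (n : ℂ) ≠ 0 := by exact_mod_cast hn.ne'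
  refine ⟨Complex.exp (((Real.log ‖w‖ / n : ℝ) : ℂ) + ((θ / n : ℝ) : ℂ) * Complex.I), ?_, ?_⟩
  · rw [Complex.exp_im]
    refine mul_pos (Real.exp_pos _) (Real.sin_pos_of_pos_of_lt_pi ?_ ?_)
    · simpa using div_pos hθ hn'
    · simpa using (div_lt_iff₀' hn').2 hθn
  · rw [← Complex.exp_nat_mul]
    have h : (n : ℂ) * (((Real.log ‖w‖ / n : ℝ) : ℂ) + ((θ / n : ℝ) : ℂ) * Complex.I) =
        (Real.log ‖w‖ : ℝ) + θ * Complex.I := by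
      push_cast
      field_simp
    rw [h, Complex.exp_add, ← Complex.ofReal_exp, Real.exp_log (norm_pos_iff.2 hw), ← hwθ]

theorem exists_im_pos_pow_eq_of_im_pos (n : ℕ) (hn : 0 < n) (w : ℂ) (hw : 0 < w.im) :
    ∃ z : ℂ, 0 < z.im ∧ z ^ n = w := by
  have hw0 : w ≠ 0 := by rintro rfl; simp at hw
  refine exists_im_pos_pow_eq_of_angle n hn w hw0 w.arg ?_ ?_
    (Complex.norm_mul_exp_arg_mul_I w).symm
  · refine lt_of_le_of_ne (Complex.arg_nonneg_iff.2 hw.le) fun h => ?_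
    exact hw.ne' (Complex.arg_eq_zero_iff.1 h.symm).2
  · have h1 : w.arg < Real.pi := Complex.arg_lt_pi_iff.2 (Or.inr hw.ne')
    have h2 : (1 : ℝ) ≤ n := by exact_mod_cast hn
    nlinarith [Real.pi_pos]

theorem exists_im_pos_pow_eq_of_three_le (n : ℕ) (hn : 3 ≤ n) (w : ℂ) (hw : w ≠ 0) :
    ∃ z : ℂ, 0 < z.im ∧ z ^ n = w := by
  have h2 : (3 : ℝ) ≤ n := by exact_mod_cast hn
  have hpi := Real.pi_pos
  rcases lt_or_ge 0 w.arg with h | h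
  · refine exists_im_pos_pow_eq_of_angle n (by omega) w hw w.arg h ?_
      (Complex.norm_mul_exp_arg_mul_I w).symm
    nlinarith [Complex.arg_le_pi w]
  -- The shifted angle lies in `(π, 2π]`, and `2π < 3π ≤ nπ`.
  · refine exists_im_pos_pow_eq_of_angle n (by omega) w hw (w.arg + 2 * Real.pi) ?_ ?_ ?_
    · linarith [Complex.neg_pi_lt_arg w]
    · nlinarith
    · push_cast
      rw [add_mul, Complex.exp_add, Complex.exp_two_pi_mul_I, mul_one,
        Complex.norm_mul_exp_arg_mul_I]

-- One of the two square roots lies in the upper half plane unless both are real, which forces `w ≥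
-- 0`.
open scoped ComplexOrder in
theorem exists_im_pos_sq_eq (w : ℂ) (hw : ¬ 0 ≤ w) : ∃ z : ℂ, 0 < z.im ∧ z ^ 2 = w := by
  obtain ⟨z, hz⟩ := IsAlgClosed.exists_pow_nat_eq w (n := 2) (by norm_num)
  rcases lt_trichotomy z.im 0 with h | h | h
  · exact ⟨-z, by simpa using h, by simpa using hz⟩
  · refine absurd ?_ hw
    rw [← hz, Complex.nonneg_iff, sq, Complex.mul_re, Complex.mul_im, h]
    constructor
    · nlinarith [sq_nonneg z.re]
    · ring
  · exact ⟨z, h, hz⟩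

/-! ### Restriction to scalar blocks -/

theorem eval_detMonomial_diagonal {k : ℕ} (d : Fin k → ℕ) (α : Fin k → ℕ) (z : Fin k → ℂ) :
    MvPolynomial.eval (symEntries (Matrix.diagonal fun x : BlockIndex d => z x.1)
      (Matrix.isSymm_diagonal _)) (detMonomial d α) = ∏ i, (z i ^ d i) ^ α i := by
  rw [detMonomial, map_prod]
  refine Finset.prod_congr rfl fun i _ => ?_
  rw [map_pow, RingHom.map_det]
  congr 1
  have h : (MvPolynomial.eval (symEntries (Matrix.diagonal fun x : BlockIndex d => z x.1)
      (Matrix.isSymm_diagonal _))).mapMatrix (varBlock d i) =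
      Matrix.diagonal fun _ : Fin (d i) => z i := by
    ext a b
    by_cases hab : a = b
    · simp [varBlock, symEntries, hab]
    · simp [varBlock, symEntries, hab, Matrix.diagonal_apply]
  rw [h]
  simp

/-- Evaluating a psd-stable polynomial of determinants on scalar diagonal blocks. -/
theorem PsdStable.sum_ne_zero {k : ℕ} {d : Fin k → ℕ} {γ : Fin k → ℕ} {B : Finset (Fin k → ℕ)}
    {c : (Fin k → ℕ) → ℂ} (hf : PsdStable (detMonomial d γ * polyOfDets d B c))
    (w : Fin k → ℂ) (hw : ∀ i, ∃ z : ℂ, 0 < z.im ∧ z ^ d i = w i) :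
    ∑ β ∈ B, c β * ∏ i, w i ^ β i ≠ 0 := by
  choose z hz hzw using hw
  have h := hf (Matrix.diagonal fun x : BlockIndex d => z x.1) (Matrix.isSymm_diagonal _) (by
    rw [Matrix.diagonal_map (by simp)]
    exact Matrix.PosDef.diagonal fun x => hz x.1)
  rw [map_mul] at h
  have h' := right_ne_zero_of_mul h
  simpa [polyOfDets, eval_detMonomial_diagonal, hzw] using h'

/-! ### Expansion in one variable -/

/-- The coefficient of the `m`-th power of the `i`-th variable in `∑_{β ∈ B} c_β w^β`, a polynomial
in the other variables. -/
noncomputable def sliceCoeff {k : ℕ} (B : Finset (Fin k → ℕ)) (c : (Fin k → ℕ) → ℂ) (i : Fin k)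
    (m : ℕ) : MvPolynomial (Fin k) ℂ :=
  ∑ β ∈ B with β i = m,
    MvPolynomial.monomial (Finsupp.equivFunOnFinite.symm (Function.update β i 0)) (c β)

/-- Once the `i`-th exponent is fixed to `m`, erasing it loses no information, so distinct `β` give
distinct monomials and nothing cancels. -/
theorem coeff_sliceCoeff {k : ℕ} (B : Finset (Fin k → ℕ)) (c : (Fin k → ℕ) → ℂ) (i : Fin k)
    (m : ℕ) (β : Fin k → ℕ) :
    (sliceCoeff B c i m).coeff (Finsupp.equivFunOnFinite.symm (Function.update β i 0)) =
      if Function.update β i m ∈ B then c (Function.update β i m) else 0 := by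
  have key : ∀ β' : Fin k → ℕ, β' i = m →
      (Function.update β' i 0 = Function.update β i 0 ↔ β' = Function.update β i m) := by
    intro β' h
    constructor
    · intro h'
      rw [← h, ← Function.update_idem (0 : ℕ) (β' i) β, ← h', Function.update_idem,
        Function.update_eq_self]
    · rintro rfl
      simp
  rw [sliceCoeff, MvPolynomial.coeff_sum, Finset.sum_filter, ← Finset.sum_ite_eq' B]
  refine Finset.sum_congr rfl fun β' _ => ?_
  simp only [MvPolynomial.coeff_monomial, Finsupp.equivFunOnFinite.symm.injective.eq_iff]
  by_cases h : β' i = m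
  · simp only [if_pos h, key β' h]
  · rw [if_neg h, if_neg]
    rintro rfl
    simp at h

theorem sliceCoeff_ne_zero {k : ℕ} {B : Finset (Fin k → ℕ)} {c : (Fin k → ℕ) → ℂ}
    (hc : ∀ β ∈ B, c β ≠ 0) (i : Fin k) {β : Fin k → ℕ} (hβ : β ∈ B) :
    sliceCoeff B c i (β i) ≠ 0 := by
  intro h
  have := coeff_sliceCoeff B c i (β i) β
  rw [h, Function.update_eq_self, if_pos hβ] at this
  exact hc β hβ (by simpa using this.symm)

/-- The univariate polynomial in the `i`-th variable obtained from `∑_{β ∈ B} c_β w^β` by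
specializing the other variables. -/
noncomputable def slice {k : ℕ} (B : Finset (Fin k → ℕ)) (c : (Fin k → ℕ) → ℂ) (i : Fin k)
    (w : Fin k → ℂ) : Polynomial ℂ :=
  ∑ m ∈ Finset.range (B.sup (fun β => β i) + 1),
    Polynomial.C (MvPolynomial.eval w (sliceCoeff B c i m)) * Polynomial.X ^ m

theorem coeff_slice {k : ℕ} (B : Finset (Fin k → ℕ)) (c : (Fin k → ℕ) → ℂ) (i : Fin k)
    (w : Fin k → ℂ) {m : ℕ} (hm : m ≤ B.sup fun β => β i) :
    (slice B c i w).coeff m = MvPolynomial.eval w (sliceCoeff B c i m) := by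
  simp [slice, Polynomial.coeff_C_mul, Polynomial.coeff_X_pow]
  omega

theorem natDegree_slice_le {k : ℕ} (B : Finset (Fin k → ℕ)) (c : (Fin k → ℕ) → ℂ) (i : Fin k)
    (w : Fin k → ℂ) : (slice B c i w).natDegree ≤ B.sup fun β => β i := by
  refine Polynomial.natDegree_sum_le_of_forall_le _ _ fun m hm => ?_
  exact (Polynomial.natDegree_C_mul_X_pow_le _ _).trans (Nat.lt_succ_iff.1 (Finset.mem_range.1 hm))

theorem eval_slice {k : ℕ} (B : Finset (Fin k → ℕ)) (c : (Fin k → ℕ) → ℂ) (i : Fin k)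
    (w : Fin k → ℂ) (x : ℂ) :
    (slice B c i w).eval x = ∑ β ∈ B, c β * ∏ j, Function.update w i x j ^ β j := by
  rw [← Finset.sum_fiberwise_of_maps_to (g := fun β : Fin k → ℕ => β i)
    (t := Finset.range (B.sup (fun β => β i) + 1))
    (fun β hβ => Finset.mem_range.2
      (Nat.lt_succ_of_le (Finset.le_sup (f := fun β : Fin k → ℕ => β i) hβ))),
    slice, Polynomial.eval_finsetSum]
  refine Finset.sum_congr rfl fun m _ => ?_
  rw [Polynomial.eval_mul, Polynomial.eval_C, Polynomial.eval_pow, Polynomial.eval_X, sliceCoeff,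
    map_sum, Finset.sum_mul]
  refine Finset.sum_congr rfl fun β hβ => ?_
  rw [MvPolynomial.eval_monomial, mul_assoc, Finsupp.prod_fintype _ _ (fun _ => pow_zero _),
    Fintype.prod_eq_mul_prod_compl i, Fintype.prod_eq_mul_prod_compl i]
  simp only [Finsupp.equivFunOnFinite_symm_apply_apply, Function.update_self, pow_zero, one_mul,
    (Finset.mem_filter.1 hβ).2]
  rw [mul_comm (x ^ m)]
  congr 2
  refine Finset.prod_congr rfl fun j hj => ?_
  have hji : j ≠ i := by simpa using hj
  simp [Function.update_of_ne hji]

/-! ### Generic points, real quotients and positive roots -/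

theorem exists_im_pos_eval_ne_zero {k : ℕ} (p : MvPolynomial (Fin k) ℂ) (hp : p ≠ 0) :
    ∃ w : Fin k → ℂ, (∀ i, 0 < (w i).im) ∧ MvPolynomial.eval w p ≠ 0 := by
  by_contra! h
  refine hp (MvPolynomial.funext_set (fun _ => {z : ℂ | 0 < z.im}) (fun _ => ?_) fun w hw => ?_)
  · refine Set.infinite_of_injective_forall_mem (f := fun n : ℕ => (n : ℂ) + Complex.I) ?_ ?_
    · intro a b hab
      simpa using hab
    · intro n
      simp
  · rw [map_zero]
    exact h w fun i => hw i trivial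

theorem MvPolynomial.eq_zero_of_eventually_eval_eq_zero {σ : Type*} [Fintype σ]
    (p : MvPolynomial σ ℂ) (w : σ → ℂ) (h : ∀ᶠ x in nhds w, MvPolynomial.eval x p = 0) : p = 0 := by
  obtain ⟨ε, hε, hb⟩ := Metric.eventually_nhds_iff_ball.1 h
  refine MvPolynomial.funext_set (fun i => Metric.ball (w i) ε) (fun i => ?_) fun x hx => ?_
  · exact infinite_of_mem_nhds (w i) (Metric.ball_mem_nhds _ hε)
  · rw [map_zero]
    refine hb x ?_
    rw [ball_pi _ hε]
    exact hx

/-- A quotient of polynomials which only takes real values near a point is constant. -/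
theorem MvPolynomial.eq_C_mul_of_eventually_real {σ : Type*} [Fintype σ]
    (p q : MvPolynomial σ ℂ) (w : σ → ℂ) (hq : MvPolynomial.eval w q ≠ 0)
    (h : ∀ᶠ x in nhds w, (MvPolynomial.eval x p / MvPolynomial.eval x q).im = 0) :
    p = MvPolynomial.C (MvPolynomial.eval w p / MvPolynomial.eval w q) * q := by
  have hpa : AnalyticAt ℂ (fun x => MvPolynomial.eval x p) w :=
    AnalyticOnNhd.eval_mvPolynomial p w trivial
  have hqa : AnalyticAt ℂ (fun x => MvPolynomial.eval x q) w :=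
    AnalyticOnNhd.eval_mvPolynomial q w trivial
  rw [← sub_eq_zero]
  refine MvPolynomial.eq_zero_of_eventually_eval_eq_zero _ w ?_
  -- Open mapping: a nonconstant quotient would fill a neighbourhood of its value, including points
  -- off the real line.
  rcases (hpa.fun_div hqa hq).eventually_constant_or_nhds_le_map_nhds with hc | ho
  · filter_upwards [hc, hqa.continuousAt.eventually_ne hq] with x hx hqx
    rw [map_sub, map_mul, MvPolynomial.eval_C, ← hx]
    field_simp
    ring
  · exfalso
    have h' : ∀ᶠ y in nhds (MvPolynomial.eval w p / MvPolynomial.eval w q), y.im = 0 := ho h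
    obtain ⟨ε, hε, hb⟩ := Metric.eventually_nhds_iff.1 h'
    have h0 := h.self_of_nhds
    have := @hb (MvPolynomial.eval w p / MvPolynomial.eval w q + (ε / 2 : ℝ) * Complex.I) (by
      simp [abs_of_pos hε, hε])
    rw [Complex.add_im, h0] at this
    simp at this
    exact hε.ne' this

open scoped ComplexOrder in
theorem Multiset.esymm_pos_of_pos (s : Multiset ℂ) (hs : ∀ x ∈ s, 0 < x) (n : ℕ)
    (hn : n ≤ Multiset.card s) : 0 < s.esymm n := by
  have hsum : ∀ t : Multiset ℂ, (∀ x ∈ t, 0 < x) → t ≠ 0 → 0 < t.sum := by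
    intro t
    induction t using Multiset.induction with
    | empty => simp
    | cons a t ih =>
      intro h _
      rw [Multiset.sum_cons]
      refine add_pos_of_pos_of_nonneg (h a (by simp)) (Multiset.sum_nonneg fun x hx => ?_)
      exact (h x (by simp [hx])).le
  refine hsum _ ?_ ?_
  · intro x hx
    obtain ⟨t, ht, rfl⟩ := Multiset.mem_map.1 hx
    exact Multiset.prod_pos fun y hy => hs y (Multiset.mem_of_le (Multiset.mem_powersetCard.1 ht).1 hy)
  -- The bound `n ≤ card s` ensures that the sum has at least one term.
  · rw [Ne, ← Multiset.card_eq_zero, Multiset.card_map, Multiset.card_powersetCard]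
    exact (Nat.choose_pos hn).ne'

open scoped ComplexOrder in
/-- If all roots of a complex polynomial are positive, then the ratios of its coefficients are real
and nonzero. -/
theorem Polynomial.coeff_div_leadingCoeff_of_roots_pos (p : Polynomial ℂ) (hp : p ≠ 0)
    (hr : ∀ x ∈ p.roots, 0 < x) {m : ℕ} (hm : m ≤ p.natDegree) :
    (p.coeff m / p.leadingCoeff).im = 0 ∧ p.coeff m ≠ 0 := by
  have hl : p.leadingCoeff ≠ 0 := Polynomial.leadingCoeff_ne_zero.2 hp
  have hs := IsAlgClosed.splits p
  have he := Multiset.esymm_pos_of_pos p.roots hr (p.natDegree - m)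
    (by rw [Polynomial.splits_iff_card_roots.1 hs]; exact Nat.sub_le _ _)
  rw [Polynomial.coeff_eq_esymm_roots_of_splits hs hm]
  refine ⟨?_, by simp [hl, he.ne']⟩
  rw [mul_assoc, mul_div_cancel_left₀ _ hl]
  have him := (Complex.pos_iff.1 he).2
  rcases neg_one_pow_eq_or ℂ (p.natDegree - m) with h | h <;> simp [h, ← him]

/-! ### The two claims -/

/-- Otherwise `det Z_i` could still be factored out. -/
theorem IsStandardForm.exists_mem_eq_zero {k : ℕ} {d : Fin k → ℕ}
    {f : SymMatPoly (BlockIndex d)} {γ : Fin k → ℕ} {B : Finset (Fin k → ℕ)}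
    {c : (Fin k → ℕ) → ℂ} (hform : IsStandardForm d f γ B c) (i : Fin k) :
    ∃ β ∈ B, β i = 0 := by
  by_contra! h
  have := congrFun (hform.no_common_factor (Pi.single i 1) fun β hβ j => ?_) i
  · simp at this
  · by_cases hj : j = i
    · subst hj
      simpa [Nat.one_le_iff_ne_zero] using h β hβ
    · simp [hj]

/-- The size of a block that appears in the standard form of a psd-stable polynomial of
determinants is at most two. -/
theorem IsStandardForm.blockSize_le_two {k : ℕ} {d : Fin k → ℕ} (hd : ∀ i, 0 < d i)
    {f : SymMatPoly (BlockIndex d)} {γ : Fin k → ℕ} {B : Finset (Fin k → ℕ)}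
    {c : (Fin k → ℕ) → ℂ} (hform : IsStandardForm d f γ B c) (hf : PsdStable f) (i : Fin k)
    {β : Fin k → ℕ} (hβ : β ∈ B) (hβi : 0 < β i) : d i ≤ 2 := by
  by_contra! hdi
  rw [hform.eq] at hf
  obtain ⟨β₀, hβ₀, hβ₀i⟩ := hform.exists_mem_eq_zero i
  have h0 := sliceCoeff_ne_zero hform.coeff_ne_zero i hβ₀
  rw [hβ₀i] at h0
  -- At this point both the constant term and a coefficient of positive degree survive, so the slice
  -- has a root, and it is nonzero.
  obtain ⟨w, hw, hne⟩ := exists_im_pos_eval_ne_zero _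
    (mul_ne_zero h0 (sliceCoeff_ne_zero hform.coeff_ne_zero i hβ))
  rw [map_mul] at hne
  have hc0 : (slice B c i w).coeff 0 ≠ 0 := by
    rw [coeff_slice B c i w (Nat.zero_le _)]
    exact left_ne_zero_of_mul hne
  have hcβ : (slice B c i w).coeff (β i) ≠ 0 := by
    rw [coeff_slice B c i w (Finset.le_sup (f := fun β : Fin k → ℕ => β i) hβ)]
    exact right_ne_zero_of_mul hne
  obtain ⟨x, hx⟩ := IsAlgClosed.exists_root (slice B c i w) fun hdeg =>
    hcβ (Polynomial.coeff_eq_zero_of_degree_lt (by rw [hdeg]; exact_mod_cast hβi))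
  have hx0 : x ≠ 0 := by
    rintro rfl
    exact hc0 (by rwa [Polynomial.IsRoot, ← Polynomial.coeff_zero_eq_eval_zero] at hx)
  refine hf.sum_ne_zero (Function.update w i x) (fun j => ?_) ((eval_slice B c i w x).symm.trans hx)
  by_cases hj : j = i
  · subst hj
    rw [Function.update_self]
    exact exists_im_pos_pow_eq_of_three_le _ hdi x hx0
  · rw [Function.update_of_ne hj]
    exact exists_im_pos_pow_eq_of_im_pos _ (hd j) _ (hw j)

open scoped ComplexOrder in
/-- For a block of size two, the coefficients of the powers of its determinant are nonzero
multiples of each other. -/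
theorem IsStandardForm.sliceCoeff_proportional {k : ℕ} {d : Fin k → ℕ} (hd : ∀ i, 0 < d i)
    {f : SymMatPoly (BlockIndex d)} {γ : Fin k → ℕ} {B : Finset (Fin k → ℕ)}
    {c : (Fin k → ℕ) → ℂ} (hform : IsStandardForm d f γ B c) (hf : PsdStable f) (i : Fin k)
    (hdi : d i = 2) {m : ℕ} (hm : m ≤ B.sup fun β => β i) :
    ∃ r : ℂ, r ≠ 0 ∧ sliceCoeff B c i m =
      MvPolynomial.C r * sliceCoeff B c i (B.sup fun β => β i) := by
  rw [hform.eq] at hf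
  obtain ⟨β₀, hβ₀, hβ₀i⟩ := hform.exists_mem_eq_zero i
  have h0 := sliceCoeff_ne_zero hform.coeff_ne_zero i hβ₀
  rw [hβ₀i] at h0
  obtain ⟨β₁, hβ₁, hβ₁i⟩ := Finset.exists_mem_eq_sup B ⟨β₀, hβ₀⟩ fun β => β i
  have h1 := sliceCoeff_ne_zero hform.coeff_ne_zero i hβ₁
  rw [← hβ₁i] at h1
  have key : ∀ w : Fin k → ℂ, (∀ j, 0 < (w j).im) →
      MvPolynomial.eval w (sliceCoeff B c i 0) ≠ 0 →
      MvPolynomial.eval w (sliceCoeff B c i (B.sup fun β => β i)) ≠ 0 →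
      (MvPolynomial.eval w (sliceCoeff B c i m) /
        MvPolynomial.eval w (sliceCoeff B c i (B.sup fun β => β i))).im = 0 ∧
      MvPolynomial.eval w (sliceCoeff B c i m) ≠ 0 := by
    intro w hw hw0 hw1
    rw [← coeff_slice B c i w (Nat.zero_le _)] at hw0
    rw [← coeff_slice B c i w le_rfl] at hw1 ⊢
    rw [← coeff_slice B c i w hm]
    have hdeg := le_antisymm (natDegree_slice_le B c i w) (Polynomial.le_natDegree_of_ne_zero hw1)
    have hp : slice B c i w ≠ 0 := by
      intro h
      simp [h] at hw0
    rw [← hdeg]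
    refine Polynomial.coeff_div_leadingCoeff_of_roots_pos _ hp (fun x hx => ?_) (hdeg ▸ hm)
    rw [Polynomial.mem_roots hp] at hx
    have hx0 : x ≠ 0 := by
      rintro rfl
      exact hw0 (by rwa [Polynomial.IsRoot, ← Polynomial.coeff_zero_eq_eval_zero] at hx)
    refine lt_of_le_of_ne ?_ hx0.symm
    by_contra hneg
    refine hf.sum_ne_zero (Function.update w i x) (fun j => ?_)
      ((eval_slice B c i w x).symm.trans hx)
    by_cases hj : j = i
    · subst hj
      rw [Function.update_self, hdi]
      exact exists_im_pos_sq_eq x hneg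
    · rw [Function.update_of_ne hj]
      exact exists_im_pos_pow_eq_of_im_pos _ (hd j) _ (hw j)
  -- The conditions required by `key` hold at `w` and are open, so the ratio is real on a whole
  -- neighbourhood.
  obtain ⟨w, hw, hne⟩ := exists_im_pos_eval_ne_zero _ (mul_ne_zero h0 h1)
  rw [map_mul] at hne
  have hw0 := left_ne_zero_of_mul hne
  have hw1 := right_ne_zero_of_mul hne
  refine ⟨_, div_ne_zero (key w hw hw0 hw1).2 hw1,
    MvPolynomial.eq_C_mul_of_eventually_real _ _ w hw1 ?_⟩
  have hcont : ∀ p : MvPolynomial (Fin k) ℂ,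
      ContinuousAt (fun x => MvPolynomial.eval x p) w := fun p =>
    (MvPolynomial.continuous_eval p).continuousAt
  have hnhds : ∀ᶠ x : Fin k → ℂ in nhds w, ∀ j, 0 < (x j).im := by
    rw [Filter.eventually_all]
    intro j
    have hj : Continuous fun x : Fin k → ℂ => (x j).im :=
      Complex.continuous_im.comp (continuous_apply j)
    exact hj.continuousAt.eventually_const_lt (hw j)
  filter_upwards [hnhds, (hcont _).eventually_ne hw0, (hcont _).eventually_ne hw1]
    with x hx hx0 hx1
  exact (key x hx hx0 hx1).1

/-- The slice coefficients at `β i` and at `m` are both multiples of the top one, the latter by a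
nonzero constant, so a monomial of the former also occurs in the latter. -/
theorem IsStandardForm.update_mem {k : ℕ} {d : Fin k → ℕ} (hd : ∀ i, 0 < d i)
    {f : SymMatPoly (BlockIndex d)} {γ : Fin k → ℕ} {B : Finset (Fin k → ℕ)}
    {c : (Fin k → ℕ) → ℂ} (hform : IsStandardForm d f γ B c) (hf : PsdStable f) (i : Fin k)
    (hdi : d i = 2) {β : Fin k → ℕ} (hβ : β ∈ B) {m : ℕ} (hm : m ≤ B.sup fun β => β i) :
    Function.update β i m ∈ B := by
  obtain ⟨r, -, hr⟩ := hform.sliceCoeff_proportional hd hf i hdi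
    (Finset.le_sup (f := fun β : Fin k → ℕ => β i) hβ)
  obtain ⟨r', hr'0, hr'⟩ := hform.sliceCoeff_proportional hd hf i hdi hm
  have h := coeff_sliceCoeff B c i (β i) β
  rw [Function.update_eq_self, if_pos hβ, hr, MvPolynomial.coeff_C_mul] at h
  have hne := right_ne_zero_of_mul (h.trans_ne (hform.coeff_ne_zero β hβ))
  have h' := coeff_sliceCoeff B c i m β
  rw [hr', MvPolynomial.coeff_C_mul] at h'
  by_contra hmem
  rw [if_neg hmem] at h'
  exact mul_ne_zero hr'0 hne h'

theorem mainTheorem7 (k : ℕ) (d : Fin k → ℕ) (hd : ∀ i, 0 < d i)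
    (f : SymMatPoly (BlockIndex d)) (γ : Fin k → ℕ)
    (B : Finset (Fin k → ℕ)) (c : (Fin k → ℕ) → ℂ)
    (hform : IsStandardForm d f γ B c) (hf : PsdStable f) :
    (∀ i : Fin k, (∃ β ∈ B, 0 < β i) → d i ≤ 2) ∧
    (∀ i : Fin k, d i = 2 → ∀ β ∈ B, ∀ t : ℤ,
      -(β i : ℤ) ≤ t → t ≤ ((B.sup fun β' => β' i : ℕ) : ℤ) - (β i : ℤ) →
        ∃ β' ∈ B, (fun j => (β' j : ℤ)) = (fun j => (β j : ℤ)) + t • Pi.single i 1) := by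
  refine ⟨fun i ⟨β, hβ, hβi⟩ => hform.blockSize_le_two hd hf i hβ hβi, ?_⟩
  intro i hdi β hβ t ht1 ht2
  refine ⟨Function.update β i ((β i : ℤ) + t).toNat,
    hform.update_mem hd hf i hdi hβ (by omega), ?_⟩
  ext j
  by_cases hj : j = i
  · subst hj
    simp only [Function.update_self, Pi.add_apply, Pi.smul_apply, Pi.single_eq_same, smul_eq_mul]
    omega
  · simp [hj]
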